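/- Let $X=(X_t)_{t\in\mathbb{R}}$ be a real-valued (two-sided) Lévy process, that is, $X$ has càdlàg sample paths, $X_0=0$, its increments $X_{t_1}-X_{t_0},\dots,X_{t_n}-X_{t_{n-1}}$ are independent for all real $t_0\le t_1\le\dots\le t_n$, and $X_t-X_s$ has the same distribution as $X_{t-s}$ for all real $s<t$. Let $\alpha>0$. The $\alpha$-Lipschitz minorant of a function $f:\mathbb{R}\to\mathbb{R}$ is, if it exists, the greatest function $m:\mathbb{R}\to\mathbb{R}$ such that $m\le f$ and $|m(s)-m(t)|\le\alpha|s-t|$ for all $s,t\in\mathbb{R}$. Write the Lévy–Khintchine formula of $X$ as $\mathbb{E}[e^{i\theta X_t}]=e^{-t\Psi(\theta)}$ for $t\ge 0$, $\theta\in\mathbb{R}$, where $$\Psi(\theta)=-ia\theta+\tfrac12\sigma^2\theta^2+\int_{\mathbb{R}}\bigl(1-e^{i\theta x}+i\theta x\,1_{\{|x|<1\}}\bigr)\,\Pi(dx)$$ with $a\in\mathbb{R}$, $\sigma\ge 0$ and $\Pi$ a measure on $\mathbb{R}$ with $\Pi(\{0\})=0$ and $\int(1\wedge x^2)\,\Pi(dx)<\infty$;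 when $\int(1\wedge|x|)\,\Pi(dx)<\infty$, let $d=a-\int_{\{|x|<1\}}x\,\Pi(dx)$. Then the sample paths of $X$ almost surely have an $\alpha$-Lipschitz minorant if and only if either 1. $\sigma=0$, $\Pi=0$ and $|d|=\alpha$, or 2. $\mathbb{E}[|X_1|]<\infty$ and $|\mathbb{E}[X_1]|<\alpha$. Moreover, condition 1 holds if and only if almost surely $X_t=\alpha t$ for all $t\in\mathbb{R}$, or almost surely $X_t=-\alpha t$ for all $t\in\mathbb{R}$. -/

import Mathlib

open MeasureTheory ProbabilityTheory Filter Topology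

/-- The function `f : ℝ → ℝ` is càdlàg: right-continuous with (finite) left limits everywhere. -/
def IsCadlagPath (f : ℝ → ℝ) : Prop :=
  ∀ t : ℝ, ContinuousWithinAt f (Set.Ici t) t ∧ ∃ l : ℝ, Tendsto f (𝓝[<] t) (𝓝 l)

/-- `X = (X_t)_{t ∈ ℝ}` is a real-valued two-sided Lévy process under `P`: it starts at zero, has
càdlàg sample paths, and its increments over the whole line are independent and stationary. -/
structure IsLevyProcess {Ω : Type*} [MeasurableSpace Ω] (P : Measure Ω) (X : ℝ → Ω → ℝ) :
    Prop where
  measurable : ∀ t : ℝ, Measurable (X t)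
  cadlag : ∀ᵐ ω ∂P, IsCadlagPath (fun t => X t ω)
  zero : ∀ᵐ ω ∂P, X 0 ω = 0
  indep_increments : HasIndepIncrements X P
  stationary_increments : ∀ s t : ℝ, s < t →
    IdentDistrib (fun ω => X t ω - X s ω) (X (t - s)) P P

/-- `ν` is a Lévy measure: it gives no mass to the origin and integrates `1 ∧ x²`
(in particular it is sigma-finite). -/
def IsLevyMeasure (ν : Measure ℝ) : Prop :=
  ν {0} = 0 ∧ ∫⁻ x, ENNReal.ofReal (min 1 (x ^ 2)) ∂ν < ⊤

/-- The Lévy-Khintchine exponent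
`Ψ(θ) = -i a θ + σ² θ² / 2 + ∫ (1 - e^{iθx} + i θ x 1_{|x| < 1}) ν(dx)`. -/
noncomputable def levyExponent (a σ : ℝ) (ν : Measure ℝ) (θ : ℝ) : ℂ :=
  -(Complex.I * a * θ) + (σ : ℂ) ^ 2 * (θ : ℂ) ^ 2 / 2 +
    ∫ x : ℝ, (1 - Complex.exp (Complex.I * θ * x) +
      Complex.I * θ * (Set.indicator {y : ℝ | |y| < 1} (fun y : ℝ => (y : ℂ)) x)) ∂ν

/-- `(a, σ, ν)` is the Lévy-Khintchine triplet of `X`: `E[e^{iθX_t}] = e^{-tΨ(θ)}` for `t ≥ 0`. -/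
def HasLevyTriplet {Ω : Type*} [MeasurableSpace Ω] (P : Measure Ω) (X : ℝ → Ω → ℝ)
    (a σ : ℝ) (ν : Measure ℝ) : Prop :=
  0 ≤ σ ∧ IsLevyMeasure ν ∧ ∀ t : ℝ, 0 ≤ t → ∀ θ : ℝ,
    ∫ ω, Complex.exp (Complex.I * θ * (X t ω)) ∂P = Complex.exp (-(t * levyExponent a σ ν θ))

/-- The drift coefficient `d = a - ∫_{|x| < 1} x ν(dx)`, meaningful when `ν` integrates `1 ∧ |x|`;
it is the number `d` with `Ψ(θ) = -i d θ + ∫ (1 - e^{iθx}) ν(dx)` when moreover `σ = 0`. -/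
noncomputable def levyDrift (a : ℝ) (ν : Measure ℝ) : ℝ :=
  a - ∫ x in {y : ℝ | |y| < 1}, x ∂ν

/-- `g` is `α`-Lipschitz on the real line. -/
def IsAlphaLipschitz (α : ℝ) (g : ℝ → ℝ) : Prop :=
  ∀ s t : ℝ, |g s - g t| ≤ α * |s - t|

/-- `m` is the `α`-Lipschitz minorant of `f`: the greatest `α`-Lipschitz function dominated by `f`
(in the pointwise order). -/
def IsLipschitzMinorant (α : ℝ) (f m : ℝ → ℝ) : Prop :=
  IsGreatest {g : ℝ → ℝ | IsAlphaLipschitz α g ∧ g ≤ f} m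

/-! A path has an `α`-Lipschitz minorant exactly when it dominates a cone `C - α|t|`: a minorant `m`
gives `C = m 0`, and conversely the inf-convolution of the path with `α|·|` is finite and is the
minorant. The question is thus when `X_t + α|t|` is almost surely bounded below.

Suppose it is. The bounds at negative times, reflected, become upper bounds in law at positive
times, so the walk `X_{nh}` grows at most linearly and Borel–Cantelli makes its steps integrable
(`integrable_of_walk_abs_le`). A walk bounded below has steps of nonnegative mean, and zero steps if
the mean vanishes (`integral_nonneg_of_walk_bddBelow`). Applied to `X_t + αt` and to its time
reversal, this gives `|E X_1| ≤ α`, with pure drift in the boundary cases.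

Suppose instead that `|E X_1| < α`. The strong law bounds `X_n + αn` below along the integers, an
Ottaviani inequality passes to the rationals (`exists_le_rat`), and right-continuity to the reals.
Both directions use the time-reversed process, whose paths need not be càdlàg; so the probabilistic
core assumes no path regularity. -/

section

variable {Ω : Type*} [MeasurableSpace Ω] {P : Measure Ω}

/-! ### Random walks bounded below -/

/-- The infimum of the partial sums (starting from the empty sum) of a real sequence. -/
noncomputable def walkInf (x : ℕ → ℝ) : ℝ := ⨅ n : ℕ, ∑ i ∈ Finset.range n, x i

lemma measurable_walkInf : Measurable walkInf := by
  unfold walkInf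
  exact Measurable.iInf fun n => Finset.measurable_sum _ fun i _ => measurable_pi_apply i

lemma bddBelow_walk_shift {x : ℕ → ℝ}
    (hx : BddBelow (Set.range fun n : ℕ => ∑ i ∈ Finset.range n, x i)) :
    BddBelow (Set.range fun n : ℕ => ∑ i ∈ Finset.range n, x (i + 1)) := by
  obtain ⟨b, hb⟩ := hx
  refine ⟨b - x 0, ?_⟩
  rintro _ ⟨n, rfl⟩
  have := hb ⟨n + 1, rfl⟩
  simp only [Finset.sum_range_succ'] at this
  simp only
  linarith

lemma walkInf_nonpos {x : ℕ → ℝ}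
    (hx : BddBelow (Set.range fun n : ℕ => ∑ i ∈ Finset.range n, x i)) : walkInf x ≤ 0 :=
  (ciInf_le hx 0).trans (by simp)

/-- Split off the empty sum; every other partial sum begins with `x 0`. For i.i.d. steps this makes
the law of the infimum a fixed point. -/
lemma walkInf_eq_min {x : ℕ → ℝ}
    (hx : BddBelow (Set.range fun n : ℕ => ∑ i ∈ Finset.range n, x i)) :
    walkInf x = min 0 (x 0 + walkInf fun i => x (i + 1)) := by
  have hs := bddBelow_walk_shift hx
  apply le_antisymm
  · refine le_min (walkInf_nonpos hx) ?_
    rw [← sub_le_iff_le_add']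
    refine le_ciInf fun n => ?_
    have := ciInf_le hx (n + 1)
    rw [Finset.sum_range_succ'] at this
    unfold walkInf
    linarith
  · refine le_ciInf fun n => ?_
    cases n with
    | zero => simp
    | succ n =>
      refine (min_le_right _ _).trans ?_
      rw [Finset.sum_range_succ']
      have := ciInf_le hs n
      unfold walkInf
      linarith

/-- Variables indexed by disjoint sets generate independent σ-algebras. -/
lemma indep_iSup_comap {ξ : ℕ → Ω → ℝ} (hm : ∀ i, Measurable (ξ i)) (hind : iIndepFun ξ P)
    {S T : Set ℕ} (hST : Disjoint S T) :
    Indep (⨆ i ∈ S, MeasurableSpace.comap (ξ i) inferInstance)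
      (⨆ i ∈ T, MeasurableSpace.comap (ξ i) inferInstance) P :=
  indep_iSup_of_disjoint (fun i => (hm i).comap_le) hind hST

omit [MeasurableSpace Ω] in
lemma measurable_iSup_comap (ξ : ℕ → Ω → ℝ) {S : Set ℕ} {i : ℕ} (hi : i ∈ S) :
    Measurable[⨆ i ∈ S, MeasurableSpace.comap (ξ i) inferInstance] (ξ i) :=
  Measurable.mono (comap_measurable (ξ i))
    (le_iSup₂_of_le (f := fun i (_ : i ∈ S) => MeasurableSpace.comap (ξ i) inferInstance)
      i hi le_rfl) le_rfl

omit [MeasurableSpace Ω] in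
lemma measurable_sum_iSup_comap (ξ : ℕ → Ω → ℝ) {S : Set ℕ} {s : Finset ℕ} (hs : ∀ i ∈ s, i ∈ S) :
    Measurable[⨆ i ∈ S, MeasurableSpace.comap (ξ i) inferInstance] fun ω => ∑ i ∈ s, ξ i ω :=
  @Finset.measurable_fun_sum _ _ _ _ _ _ (_) _ s fun i hi => measurable_iSup_comap ξ (hs i hi)

/-- If an integrable `ξ` and an independent `J` satisfy `ξ + J ~ J ≤ 0`, with `ξ` centred,
then `ξ = 0`. -/
lemma ae_eq_zero_of_identDistrib_add [IsProbabilityMeasure P] {ξ J J' : Ω → ℝ}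
    (hξ : Integrable ξ P) (h0 : ∫ ω, ξ ω ∂P = 0) (hind : IndepFun ξ J' P)
    (hJ : IdentDistrib J J' P P) (hJ0 : ∀ᵐ ω ∂P, J ω ≤ 0)
    (hadd : ∀ᵐ ω ∂P, J ω = ξ ω + J' ω) : ∀ᵐ ω ∂P, ξ ω = 0 := by
  -- `J` need not be integrable, but `exp J ≤ 1`. Comparing exponential moments and cancelling that
  -- of `J'` leaves `E exp ξ = 1 = E (1 + ξ)`, the equality case of `1 + x ≤ exp x`.
  have hu : Measurable fun y : ℝ => ENNReal.ofReal (Real.exp y) := by fun_prop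
  have e1 : ∫⁻ ω, ENNReal.ofReal (Real.exp (J ω)) ∂P
      = ∫⁻ ω, ENNReal.ofReal (Real.exp (J' ω)) ∂P := (hJ.comp hu).lintegral_eq
  have e2 : ∫⁻ ω, ENNReal.ofReal (Real.exp (J ω)) ∂P
      = (∫⁻ ω, ENNReal.ofReal (Real.exp (ξ ω)) ∂P) *
        ∫⁻ ω, ENNReal.ofReal (Real.exp (J' ω)) ∂P := by
    have := lintegral_mul_eq_lintegral_mul_lintegral_of_indepFun'' (μ := P)
      (f := fun ω => ENNReal.ofReal (Real.exp (ξ ω)))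
      (g := fun ω => ENNReal.ofReal (Real.exp (J' ω)))
      (hu.comp_aemeasurable hξ.aemeasurable) (hu.comp_aemeasurable hJ.aemeasurable_snd)
      (hind.comp hu hu)
    rw [← this]
    refine lintegral_congr_ae ?_
    filter_upwards [hadd] with ω h
    rw [h, Real.exp_add, ENNReal.ofReal_mul (Real.exp_pos _).le]
  have hfin : ∫⁻ ω, ENNReal.ofReal (Real.exp (J ω)) ∂P ≠ ⊤ := by
    refine ne_top_of_le_ne_top ENNReal.one_ne_top ?_
    calc _ ≤ ∫⁻ _ω, 1 ∂P := lintegral_mono_ae (by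
            filter_upwards [hJ0] with ω h
            simpa using Real.exp_le_one_iff.2 h)
      _ = 1 := by simp
  have hpos : ∫⁻ ω, ENNReal.ofReal (Real.exp (J' ω)) ∂P ≠ 0 := by
    intro h
    replace h := (lintegral_eq_zero_iff' (hu.comp_aemeasurable hJ.aemeasurable_snd)).1 h
    obtain ⟨ω, hω⟩ := h.exists
    exact absurd hω (by simp [Real.exp_pos])
  have e3 : ∫⁻ ω, ENNReal.ofReal (Real.exp (ξ ω)) ∂P = 1 := by
    rw [e1] at e2 hfin
    exact (ENNReal.mul_eq_right hpos hfin).1 e2.symm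
  have haes : AEStronglyMeasurable (fun ω => Real.exp (ξ ω)) P :=
    (Real.measurable_exp.comp_aemeasurable hξ.aemeasurable).aestronglyMeasurable
  have hexp : Integrable (fun ω => Real.exp (ξ ω)) P := by
    refine ⟨haes, ?_⟩
    rw [hasFiniteIntegral_iff_ofReal (ae_of_all _ fun ω => (Real.exp_pos _).le), e3]
    exact ENNReal.one_lt_top
  have e4 : ∫ ω, Real.exp (ξ ω) ∂P = 1 := by
    rw [integral_eq_lintegral_of_nonneg_ae (ae_of_all _ fun ω => (Real.exp_pos _).le) haes, e3]
    simp
  have h1 : Integrable (fun ω => ξ ω + 1) P := hξ.add (integrable_const 1)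
  have e5 : ∫ ω, (Real.exp (ξ ω) - (ξ ω + 1)) ∂P = 0 := by
    rw [integral_sub hexp h1, integral_add hξ (integrable_const 1), e4, h0]
    simp
  replace e5 := (integral_eq_zero_iff_of_nonneg
    (fun ω => by simpa using Real.add_one_le_exp (ξ ω)) (hexp.sub h1)).1 e5
  filter_upwards [e5] with ω h
  by_contra hne
  have := Real.add_one_lt_exp hne
  simp only [Pi.sub_apply, Pi.zero_apply] at h
  linarith

/-- If `J = min 0 (ξ + J')` with `J ~ J'`, then `J - J'` is integrable and centred as soon as
`ξ` is integrable. -/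
lemma integral_sub_eq_zero_of_eq_min [IsProbabilityMeasure P] {ξ J J' : Ω → ℝ}
    (hξ : Integrable ξ P) (hJ : IdentDistrib J J' P P) (hJ0 : ∀ᵐ ω ∂P, J' ω ≤ 0)
    (hmin : ∀ᵐ ω ∂P, J ω = min 0 (ξ ω + J' ω)) :
    Integrable (fun ω => J ω - J' ω) P ∧ ∫ ω, (J ω - J' ω) ∂P = 0 := by
  -- `J' = min 0 J'`, and `min 0` is 1-Lipschitz.
  have hbd : ∀ᵐ ω ∂P, |J ω - J' ω| ≤ |ξ ω| := by
    filter_upwards [hJ0, hmin] with ω h0 h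
    have := abs_min_sub_min_le_max 0 (ξ ω + J' ω) 0 (J' ω)
    rw [← h, min_eq_right h0] at this
    simpa using this
  have hmeas : AEStronglyMeasurable (fun ω => J ω - J' ω) P :=
    (hJ.aemeasurable_fst.sub hJ.aemeasurable_snd).aestronglyMeasurable
  refine ⟨hξ.mono hmeas hbd, ?_⟩
  -- Truncation at `-K` makes both terms integrable with equal means; `|ξ|` dominates as `K → ∞`.
  let φ : ℕ → ℝ → ℝ := fun K y => max (-(K : ℝ)) (min 0 y)
  have hφm : ∀ K, Measurable (φ K) := fun K => by fun_prop
  have hφb : ∀ K y, ‖φ K y‖ ≤ K := fun K y => by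
    rw [Real.norm_eq_abs, abs_le]
    exact ⟨le_max_left _ _, max_le (by simp) ((min_le_left _ _).trans (by simp))⟩
  have hφi : ∀ K (Y : Ω → ℝ), AEMeasurable Y P → Integrable (fun ω => φ K (Y ω)) P :=
    fun K Y hY => Integrable.of_bound ((hφm K).comp_aemeasurable hY).aestronglyMeasurable K
      (ae_of_all _ fun ω => hφb K _)
  have hz : ∀ K, ∫ ω, (φ K (J ω) - φ K (J' ω)) ∂P = 0 := fun K => by
    rw [integral_sub (hφi K J hJ.aemeasurable_fst) (hφi K J' hJ.aemeasurable_snd), sub_eq_zero]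
    exact (hJ.comp (hφm K)).integral_eq
  have hlim : Tendsto (fun K : ℕ => ∫ ω, (φ K (J ω) - φ K (J' ω)) ∂P) atTop
      (𝓝 (∫ ω, (J ω - J' ω) ∂P)) := by
    refine tendsto_integral_of_dominated_convergence (fun ω => |ξ ω|) (fun K =>
      ((hφi K J hJ.aemeasurable_fst).sub (hφi K J' hJ.aemeasurable_snd)).aestronglyMeasurable)
      hξ.abs (fun K => ?_) ?_
    · filter_upwards [hbd] with ω h
      refine le_trans ?_ h
      have h1 := abs_max_sub_max_le_max (-(K : ℝ)) (min 0 (J ω)) (-(K : ℝ)) (min 0 (J' ω))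
      have h2 := abs_min_sub_min_le_max 0 (J ω) 0 (J' ω)
      simp only [sub_self, abs_zero] at h1 h2
      exact h1.trans (max_le (abs_nonneg _) (h2.trans (max_le (abs_nonneg _) le_rfl)))
    · have key : ∀ y : ℝ, y ≤ 0 → Tendsto (fun K : ℕ => φ K y) atTop (𝓝 y) := fun y hy => by
        refine tendsto_const_nhds.congr' ?_
        filter_upwards [eventually_ge_atTop ⌈-y⌉₊] with K hK
        have : -y ≤ K := (Nat.le_ceil _).trans (by exact_mod_cast hK)
        simp only [φ]
        rw [min_eq_right hy, max_eq_right (by linarith)]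
      filter_upwards [hJ0, hmin] with ω h0 h
      exact (key _ (h ▸ min_le_left _ _)).sub (key _ h0)
  simp only [hz] at hlim
  exact (tendsto_nhds_unique tendsto_const_nhds hlim).symm

/-- A random walk with integrable steps that is almost surely bounded below has steps of
nonnegative mean, and vanishes if the mean is zero. -/
theorem integral_nonneg_of_walk_bddBelow [IsProbabilityMeasure P] {ξ : ℕ → Ω → ℝ}
    (hm : ∀ i, Measurable (ξ i)) (hind : iIndepFun ξ P)
    (hid : ∀ i, IdentDistrib (ξ i) (ξ 0) P P)
    (hb : ∀ᵐ ω ∂P, BddBelow (Set.range fun n : ℕ => ∑ i ∈ Finset.range n, ξ i ω))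
    (hint : Integrable (ξ 0) P) :
    0 ≤ ∫ ω, ξ 0 ω ∂P ∧ (∫ ω, ξ 0 ω ∂P = 0 → ∀ᵐ ω ∂P, ξ 0 ω = 0) := by
  set J : Ω → ℝ := fun ω => walkInf fun i => ξ i ω
  set J' : Ω → ℝ := fun ω => walkInf fun i => ξ (i + 1) ω
  have hJ : IdentDistrib J J' P P :=
    (IdentDistrib.pi (X := fun i ω => ξ i ω) (Y := fun i ω => ξ (i + 1) ω)
      (fun i => (hid i).trans (hid (i + 1)).symm) hind
      (hind.precomp (add_left_injective 1))).comp measurable_walkInf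
  have hmin : ∀ᵐ ω ∂P, J ω = min 0 (ξ 0 ω + J' ω) := by
    filter_upwards [hb] with ω h using walkInf_eq_min h
  have hJ0 : ∀ᵐ ω ∂P, J ω ≤ 0 := by filter_upwards [hb] with ω h using walkInf_nonpos h
  have hJ0' : ∀ᵐ ω ∂P, J' ω ≤ 0 := by
    filter_upwards [hb] with ω h using walkInf_nonpos (bddBelow_walk_shift h)
  obtain ⟨hi, hz⟩ := integral_sub_eq_zero_of_eq_min hint hJ hJ0' hmin
  have hle : ∀ᵐ ω ∂P, J ω - J' ω ≤ ξ 0 ω := by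
    filter_upwards [hmin] with ω h
    rw [h]
    linarith [min_le_right 0 (ξ 0 ω + J' ω)]
  refine ⟨hz ▸ integral_mono_ae hi hint hle, fun h0 => ?_⟩
  have hind' : IndepFun (ξ 0) J' P := by
    have := indep_iSup_comap hm hind (S := {0}) (T := Set.Ici 1) (by simp)
    refine (IndepFun_iff_Indep _ _ _).2 (indep_of_indep_of_le_left
      (indep_of_indep_of_le_right this ?_) ?_)
    · refine Measurable.comap_le ?_
      refine measurable_walkInf.comp
        (@measurable_pi_lambda _ _ _ (_) _ _ fun i => ?_)
      exact measurable_iSup_comap ξ (by simp)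
    · exact (measurable_iSup_comap ξ (by simp)).comap_le
  refine ae_eq_zero_of_identDistrib_add hint h0 hind' hJ hJ0 ?_
  -- `ξ - (J - J')` is nonnegative with mean zero, so the minimum with `0` is almost surely
  -- inactive.
  have hd : ∫ ω, (ξ 0 ω - (J ω - J' ω)) ∂P = 0 := by rw [integral_sub hint hi, h0, hz, sub_zero]
  replace hd := (integral_eq_zero_iff_of_nonneg_ae
    (by filter_upwards [hle] with ω h using sub_nonneg.2 h) (hint.sub hi)).1 hd
  filter_upwards [hd] with ω h
  simp only [Pi.sub_apply, Pi.zero_apply] at h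
  linarith

/-! ### Linear growth and integrability -/

lemma integrable_of_tsum_measure_lt_ne_top {Y : Ω → ℝ} (hY : Measurable Y)
    (h : ∑' n : ℕ, P {ω | (n : ℝ) < |Y ω|} ≠ ⊤) : Integrable Y P := by
  refine ⟨hY.aestronglyMeasurable, lt_of_le_of_lt ?_ h.lt_top⟩
  have hs : ∀ n : ℕ, MeasurableSet {ω | (n : ℝ) < |Y ω|} := fun n =>
    measurableSet_lt measurable_const hY.abs
  calc ∫⁻ ω, ‖Y ω‖ₑ ∂P
      ≤ ∫⁻ ω, ∑' n : ℕ, {ω | (n : ℝ) < |Y ω|}.indicator 1 ω ∂P := by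
        refine lintegral_mono fun ω => ?_
        calc ‖Y ω‖ₑ ≤ ((⌈|Y ω|⌉₊ : ℕ) : ENNReal) := by
              rw [Real.enorm_eq_ofReal_abs]
              exact ENNReal.ofReal_le_of_le_toReal (by simpa using Nat.le_ceil _)
          _ = ∑ n ∈ Finset.range ⌈|Y ω|⌉₊, {ω | (n : ℝ) < |Y ω|}.indicator 1 ω := by
              rw [Finset.sum_congr rfl (g := fun _ => (1 : ENNReal))]
              · simp
              · intro n hn
                rw [Finset.mem_range, Nat.lt_ceil] at hn
                simp [hn]
          _ ≤ _ := ENNReal.sum_le_tsum _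
    _ = ∑' n : ℕ, P {ω | (n : ℝ) < |Y ω|} := by
        rw [lintegral_tsum fun n => (measurable_one.indicator (hs n)).aemeasurable]
        simp [lintegral_indicator_one (hs _)]

/-- A random walk that grows at most linearly has integrable steps. -/
theorem integrable_of_walk_abs_le [IsProbabilityMeasure P] {ξ : ℕ → Ω → ℝ}
    (hm : ∀ i, Measurable (ξ i)) (hind : iIndepFun ξ P)
    (hid : ∀ i, IdentDistrib (ξ i) (ξ 0) P P) {β : ℝ} (hβ : 0 < β)
    (hb : ∀ᵐ ω ∂P, ∃ C : ℝ, ∀ n : ℕ, |∑ i ∈ Finset.range n, ξ i ω| ≤ C + β * n) :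
    Integrable (ξ 0) P := by
  -- Consecutive partial sums give `|ξ n| ≤ 2C + β + 2βn`, which is at most `3βn` once `n ≥ (2C + β)
  -- / β`. Hence almost surely only finitely many of these events occur.
  let B : ℕ → Set ℝ := fun n => {y | (n : ℝ) < |y / (3 * β)|}
  have hB : ∀ n, MeasurableSet (B n) := fun n => measurableSet_lt measurable_const (by fun_prop)
  have hsum : ∑' n : ℕ, P (ξ n ⁻¹' B n) ≠ ⊤ := by
    intro htop
    have h1 := measure_limsup_eq_one (μ := P) (s := fun n => ξ n ⁻¹' B n) (fun n => hm n (hB n))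
      ((iIndepSet_iff_meas_biInter fun n => hm n (hB n)).2 fun s =>
        hind.measure_inter_preimage_eq_mul s fun i _ => hB i) htop
    have h2 : ∀ᵐ ω ∂P, ω ∉ limsup (fun n => ξ n ⁻¹' B n) atTop := by
      filter_upwards [hb] with ω ⟨C, hC⟩
      rw [mem_limsup_iff_frequently_mem, not_frequently]
      filter_upwards [eventually_ge_atTop ⌈(2 * C + β) / β⌉₊] with n hn
      have hn' : (2 * C + β) / β ≤ n := (Nat.le_ceil _).trans (by exact_mod_cast hn)
      rw [div_le_iff₀ hβ] at hn'
      simp only [B, Set.mem_preimage, Set.mem_ofPred_eq, not_lt, abs_div,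
        abs_of_pos (show (0 : ℝ) < 3 * β by positivity)]
      rw [div_le_iff₀ (by positivity)]
      have a1 := abs_le.1 (hC n)
      have a2 := abs_le.1 (hC (n + 1))
      rw [Finset.sum_range_succ] at a2
      push_cast at a2
      rw [abs_le]
      constructor <;> nlinarith [a1.1, a1.2, a2.1, a2.2]
    have h3 : P (limsup (fun n => ξ n ⁻¹' B n) atTop) = 0 := by
      simpa [ae_iff] using h2
    simp [h3] at h1
  have : Integrable (fun ω => ξ 0 ω / (3 * β)) P := by
    refine integrable_of_tsum_measure_lt_ne_top ((hm 0).div_const _) ?_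
    convert hsum using 3 with n
    exact ((hid n).measure_mem_eq (hB n)).symm
  have h2 := this.mul_const (3 * β)
  refine h2.congr (ae_of_all _ fun ω => ?_)
  simp only
  field_simp

/-! ### Ottaviani inequality -/

/-- A one-sided Ottaviani inequality. -/
theorem measure_exists_sum_lt_le [IsProbabilityMeasure P] {ξ : ℕ → Ω → ℝ}
    (hm : ∀ i, Measurable (ξ i)) (hind : iIndepFun ξ P) {τ : ℕ → ℕ} {c : ℝ}
    (hc : ∀ k, 2⁻¹ ≤ P {ω | ∑ i ∈ Finset.Ico k (τ k), ξ i ω ≤ c}) (hτ : ∀ k, k ≤ τ k) (x : ℝ) :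
    P {ω | ∃ k, ∑ i ∈ Finset.range k, ξ i ω < -(x + c)} ≤
      2 * P {ω | ∃ k, ∑ i ∈ Finset.range (τ k), ξ i ω < -x} := by
  -- Decompose by the first passage `k` below `-(x + c)`. The increment from `k` to `τ k` is
  -- independent of it and at most `c` with probability at least `1/2`, which leaves the walk below
  -- `-x` at `τ k`.
  set A : ℕ → Set Ω := fun k => {ω | ∑ i ∈ Finset.range k, ξ i ω < -(x + c)} \
    ⋃ j ∈ Finset.range k, {ω | ∑ i ∈ Finset.range j, ξ i ω < -(x + c)} with hA
  set D : ℕ → Set Ω := fun k => {ω | ∑ i ∈ Finset.Ico k (τ k), ξ i ω ≤ c} with hD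
  have hAm : ∀ k, MeasurableSet[⨆ i ∈ Set.Iio k, MeasurableSpace.comap (ξ i) inferInstance]
      (A k) := fun k => by
    have key : ∀ j ≤ k, MeasurableSet[⨆ i ∈ Set.Iio k, MeasurableSpace.comap (ξ i) inferInstance]
        {ω | ∑ i ∈ Finset.range j, ξ i ω < -(x + c)} := fun j hj =>
      measurable_sum_iSup_comap ξ (fun i hi => lt_of_lt_of_le (Finset.mem_range.1 hi) hj)
        measurableSet_Iio
    refine (key k le_rfl).diff (Finset.measurableSet_biUnion _ fun j hj => key j ?_)
    exact (Finset.mem_range.1 hj).le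
  have hDm : ∀ k, MeasurableSet[⨆ i ∈ Set.Ici k, MeasurableSpace.comap (ξ i) inferInstance]
      (D k) := fun k =>
    measurable_sum_iSup_comap ξ (fun i hi => (Finset.mem_Ico.1 hi).1) measurableSet_Iic
  have hle : ∀ S : Set ℕ, ⨆ i ∈ S, MeasurableSpace.comap (ξ i) inferInstance ≤ ‹MeasurableSpace Ω› :=
    fun S => iSup₂_le fun i _ => (hm i).comap_le
  have hAD : ∀ k, P (A k ∩ D k) = P (A k) * P (D k) := fun k =>
    (Indep_iff _ _ _).1 (indep_iSup_comap hm hind (S := Set.Iio k) (T := Set.Ici k)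
      (Set.disjoint_left.2 fun i hi hi' => absurd (Set.mem_Iio.1 hi) (not_lt.2 hi'))) _ _ (hAm k) (hDm k)
  have hdisj : Pairwise (Function.onFun Disjoint A) := by
    intro i j hij
    rw [Function.onFun, Set.disjoint_left]
    rintro ω ⟨hi, hi'⟩ ⟨hj, hj'⟩
    simp only [Set.mem_iUnion, not_exists] at hi' hj'
    rcases lt_or_gt_of_ne hij with h | h
    · exact hj' i (Finset.mem_range.2 h) hi
    · exact hi' j (Finset.mem_range.2 h) hj
  have hU : {ω | ∃ k, ∑ i ∈ Finset.range k, ξ i ω < -(x + c)} ⊆ ⋃ k, A k := by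
    classical
    intro ω hω
    refine Set.mem_iUnion.2 ⟨Nat.find hω, Nat.find_spec hω, ?_⟩
    simp only [Set.mem_iUnion, not_exists]
    exact fun j hj => Nat.find_min hω (Finset.mem_range.1 hj)
  have hsub : ⋃ k, (A k ∩ D k) ⊆ {ω | ∃ k, ∑ i ∈ Finset.range (τ k), ξ i ω < -x} := by
    refine Set.iUnion_subset fun k => ?_
    rintro ω ⟨⟨h1, -⟩, h2⟩
    refine ⟨k, ?_⟩
    rw [← Finset.sum_range_add_sum_Ico _ (hτ k)]
    simp only [hD, Set.mem_ofPred_eq] at h1 h2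
    linarith
  calc _ ≤ ∑' k, P (A k) := (measure_mono hU).trans (measure_iUnion_le A)
    _ ≤ ∑' k, 2 * P (A k ∩ D k) := ENNReal.tsum_le_tsum fun k => by
        rw [hAD]
        calc P (A k) = 2 * (P (A k) * 2⁻¹) := by
              rw [mul_left_comm, ENNReal.mul_inv_cancel (by simp) (by simp), mul_one]
          _ ≤ _ := by gcongr; exact hc k
    _ = 2 * P (⋃ k, (A k ∩ D k)) := by
        rw [ENNReal.tsum_mul_left, measure_iUnion
          (fun i j hij => (hdisj hij).mono Set.inter_subset_left Set.inter_subset_left)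
          (fun k => (hle _ _ (hAm k)).inter (hle _ _ (hDm k)))]
    _ ≤ _ := by gcongr

/-! ### Processes with stationary independent increments -/

/-- A process over the real line, null at zero, with stationary independent increments
(without any path regularity). -/
structure HasStationaryIndepIncrements (P : Measure Ω) (X : ℝ → Ω → ℝ) : Prop where
  measurable : ∀ t : ℝ, Measurable (X t)
  zero : ∀ᵐ ω ∂P, X 0 ω = 0
  indep_increments : HasIndepIncrements X P
  stationary_increments : ∀ s t : ℝ, s < t →
    IdentDistrib (fun ω => X t ω - X s ω) (X (t - s)) P P

lemma IsLevyProcess.hasStationaryIndepIncrements {X : ℝ → Ω → ℝ} (hX : IsLevyProcess P X) :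
    HasStationaryIndepIncrements P X :=
  ⟨hX.measurable, hX.zero, hX.indep_increments, hX.stationary_increments⟩

/-- The increments of a process along the arithmetic progression of step `h`. -/
def gridStep (X : ℝ → Ω → ℝ) (h : ℝ) (i : ℕ) (ω : Ω) : ℝ :=
  X (((i + 1 : ℕ) : ℝ) * h) ω - X ((i : ℝ) * h) ω

omit [MeasurableSpace Ω] in
lemma sum_range_gridStep (X : ℝ → Ω → ℝ) (h : ℝ) (n : ℕ) (ω : Ω) :
    ∑ i ∈ Finset.range n, gridStep X h i ω = X (n * h) ω - X 0 ω := by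
  have := Finset.sum_range_sub (fun i : ℕ => X ((i : ℝ) * h) ω) n
  simpa only [gridStep, Nat.cast_zero, zero_mul] using this

omit [MeasurableSpace Ω] in
lemma sum_Ico_gridStep (X : ℝ → Ω → ℝ) (h : ℝ) {k n : ℕ} (hkn : k ≤ n) (ω : Ω) :
    ∑ i ∈ Finset.Ico k n, gridStep X h i ω = X (n * h) ω - X (k * h) ω := by
  rw [Finset.sum_Ico_eq_sub _ hkn, sum_range_gridStep, sum_range_gridStep]
  ring

namespace HasStationaryIndepIncrements

variable {X : ℝ → Ω → ℝ}

lemma measurable_gridStep (hX : HasStationaryIndepIncrements P X) (h : ℝ) (i : ℕ) :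
    Measurable (gridStep X h i) := (hX.measurable _).sub (hX.measurable _)

lemma iIndepFun_gridStep (hX : HasStationaryIndepIncrements P X) {h : ℝ} (hh : 0 ≤ h) :
    iIndepFun (gridStep X h) P :=
  hX.indep_increments.nat (t := fun i : ℕ => (i : ℝ) * h) fun i j hij => by
    simp only
    gcongr

lemma identDistrib_gridStep (hX : HasStationaryIndepIncrements P X) {h : ℝ} (hh : 0 < h) (i : ℕ) :
    IdentDistrib (gridStep X h i) (X h) P P := by
  have := hX.stationary_increments ((i : ℝ) * h) (((i + 1 : ℕ) : ℝ) * h) (by push_cast; nlinarith)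
  rwa [show ((i + 1 : ℕ) : ℝ) * h - i * h = h by push_cast; ring] at this

lemma identDistrib_neg_neg (hX : HasStationaryIndepIncrements P X) {t : ℝ} (ht : 0 < t) :
    IdentDistrib (fun ω => -X (-t) ω) (X t) P P := by
  have h := hX.stationary_increments (-t) 0 (by linarith)
  rw [zero_sub, neg_neg] at h
  refine IdentDistrib.trans (.of_ae_eq (hX.measurable _).neg.aemeasurable ?_) h
  filter_upwards [hX.zero] with ω h0
  rw [h0, zero_sub]

lemma comp_neg (hX : HasStationaryIndepIncrements P X) :
    HasStationaryIndepIncrements P fun t => X (-t) where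
  measurable t := hX.measurable _
  zero := by simpa using hX.zero
  indep_increments n t ht := by
    have h := hX.indep_increments n (fun i => -t i.rev) fun i j hij =>
      neg_le_neg (ht (Fin.rev_le_rev.2 hij))
    have h2 := (h.precomp Fin.rev_injective).comp (fun _ x => -x) fun _ => measurable_neg
    convert h2 using 2 with i
    ext ω
    simp [Fin.rev_succ, Fin.rev_castSucc]
  stationary_increments s t hst := by
    have h1 := (hX.stationary_increments (-t) (-s) (by linarith)).comp measurable_neg
    have h2 := (hX.identDistrib_neg_neg (sub_pos.2 hst)).comp measurable_neg
    rw [show -s - -t = t - s by ring] at h1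
    convert h1.trans h2.symm using 1
    · ext ω; simp
    · ext ω; simp

lemma add_drift (hX : HasStationaryIndepIncrements P X) (a : ℝ) :
    HasStationaryIndepIncrements P fun t ω => X t ω + a * t where
  measurable t := (hX.measurable t).add_const _
  zero := by simpa using hX.zero
  indep_increments n t ht := by
    have h := (hX.indep_increments n t ht).comp
      (fun i x => x + (a * t i.succ - a * t i.castSucc)) fun _ => by fun_prop
    convert h using 2 with i
    ext ω
    simp only [Function.comp_apply]
    ring
  stationary_increments s t hst := by
    have h := (hX.stationary_increments s t hst).comp
      (show Measurable fun x : ℝ => x + a * (t - s) by fun_prop)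
    convert h using 1
    · ext ω
      simp only [Function.comp_apply]
      ring
    · rfl

/-- Drift to infinity along the integers. -/
lemma bddBelow_range_nat [IsProbabilityMeasure P] (hX : HasStationaryIndepIncrements P X)
    (hint : Integrable (X 1) P) (hpos : 0 < ∫ ω, X 1 ω ∂P) :
    ∀ᵐ ω ∂P, BddBelow (Set.range fun n : ℕ => X n ω) := by
  have hid := hX.identDistrib_gridStep one_pos
  have := strong_law_ae_real (gridStep X 1) ((hid 0).integrable_iff.2 hint)
    (fun i j hij => (hX.iIndepFun_gridStep zero_le_one).indepFun hij)
    (fun i => (hid i).trans (hid 0).symm)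
  rw [(hid 0).integral_eq] at this
  filter_upwards [this] with ω h
  refine IsBoundedUnder.bddBelow_range ⟨X 0 ω, ?_⟩
  rw [eventually_map]
  filter_upwards [h.eventually (lt_mem_nhds hpos)] with n hn
  rw [sum_range_gridStep, mul_one] at hn
  have : 0 < X n ω - X 0 ω := by
    by_contra hcon
    exact absurd hn (not_lt.2 (div_nonpos_of_nonpos_of_nonneg (not_lt.1 hcon) n.cast_nonneg))
  simp only [ge_iff_le]
  linarith

/-- On a grid of mesh `1 / r`, the infimum is controlled by the infimum over the integers. -/
lemma measure_exists_grid_lt_le [IsProbabilityMeasure P] (hX : HasStationaryIndepIncrements P X)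
    {c : ℝ} (hc : ∀ s ∈ Set.Ioc (0 : ℝ) 1, 2⁻¹ ≤ P {ω | X s ω ≤ c}) {r : ℕ} (hr : 0 < r) (x : ℝ) :
    P {ω | ∃ k : ℕ, X (k / r) ω - X 0 ω < -(x + c)} ≤
      2 * P {ω | ∃ n : ℕ, X n ω - X 0 ω < -x} := by
  have hr' : (0 : ℝ) < r := by exact_mod_cast hr
  have hτ : ∀ k, k < r * (k / r + 1) := fun k => Nat.lt_mul_div_succ k hr
  have key := measure_exists_sum_lt_le (P := P) (ξ := gridStep X (r : ℝ)⁻¹)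
    -- The first integer time strictly after `k / r`. The waiting time lies in `(0, 1]`, as
    -- stationarity and `hc` require.
    (τ := fun k => r * (k / r + 1)) (c := c)
    (hX.measurable_gridStep _) (hX.iIndepFun_gridStep (by positivity)) (fun k => ?_)
    (fun k => (hτ k).le) x
  · simp only [sum_range_gridStep] at key
    refine le_trans (le_of_eq ?_) (key.trans ?_)
    · simp only [div_eq_mul_inv]
    · gcongr 2 * P ?_
      rintro ω ⟨k, hk⟩
      refine ⟨k / r + 1, ?_⟩
      convert hk using 3
      push_cast
      field_simp
  · have hlt : (k : ℝ) < (r * (k / r + 1) : ℕ) := by exact_mod_cast hτ k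
    have hle : ((r * (k / r + 1) : ℕ) : ℝ) ≤ k + r := by
      have : r * (k / r + 1) ≤ k + r := by
        rw [mul_add, mul_one]
        exact Nat.add_le_add_right (Nat.mul_div_le k r) r
      exact_mod_cast this
    have h1 := hX.stationary_increments (k * (r : ℝ)⁻¹) ((r * (k / r + 1) : ℕ) * (r : ℝ)⁻¹)
      (by gcongr)
    have h2 := h1.measure_mem_eq (measurableSet_Iic (a := c))
    simp only [sum_Ico_gridStep X _ (hτ k).le]
    refine (hc _ ⟨?_, ?_⟩).trans h2.ge
    · rw [← sub_mul]
      exact mul_pos (sub_pos.2 hlt) (by positivity)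
    · rw [← sub_mul, ← div_eq_mul_inv, div_le_one hr']
      linarith

/-- A process with stationary independent increments that is bounded below along the integers is
bounded below along the rationals. -/
theorem exists_le_rat [IsProbabilityMeasure P] (hX : HasStationaryIndepIncrements P X)
    {c : ℝ} (hc : ∀ s ∈ Set.Ioc (0 : ℝ) 1, 2⁻¹ ≤ P {ω | X s ω ≤ c})
    (hb : ∀ᵐ ω ∂P, BddBelow (Set.range fun n : ℕ => X n ω)) :
    ∀ᵐ ω ∂P, ∃ C : ℝ, ∀ q : ℚ, 0 ≤ q → C ≤ X q ω := by
  let A : ℕ → Set Ω := fun x => {ω | ∃ n : ℕ, X n ω - X 0 ω < -(x : ℝ)}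
  -- Meshes `1 / m!` give nested grids exhausting the nonnegative rationals, while the Ottaviani
  -- bound does not depend on `m`.
  let B : ℕ → ℕ → Set Ω := fun x m => {ω | ∃ k : ℕ, X (k / m.factorial) ω - X 0 ω < -((x : ℝ) + c)}
  have hAm : ∀ x, MeasurableSet (A x) := fun x => by
    simp only [A, Set.ofPred_exists]
    exact MeasurableSet.iUnion fun n =>
      measurableSet_lt ((hX.measurable _).sub (hX.measurable _)) measurable_const
  have hA : Tendsto (fun x => 2 * P (A x)) atTop (𝓝 0) := by
    have h0 : P (⋂ x, A x) = 0 := by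
      rw [measure_eq_zero_iff_ae_notMem]
      filter_upwards [hb] with ω ⟨b, hb⟩ hmem
      obtain ⟨n, hn⟩ := Set.mem_iInter.1 hmem ⌈X 0 ω - b⌉₊
      have h1 := hb ⟨n, rfl⟩
      have h2 := Nat.le_ceil (X 0 ω - b)
      simp only at h1
      linarith
    have := tendsto_measure_iInter_atTop (μ := P) (fun x => (hAm x).nullMeasurableSet)
      (fun x y hxy ω ⟨n, hn⟩ => ⟨n, hn.trans_le (by gcongr)⟩) ⟨0, measure_ne_top _ _⟩
    rw [h0] at this
    simpa using ENNReal.Tendsto.const_mul this (.inr (by simp))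
  have hB : ∀ x, Monotone (B x) := fun x => monotone_nat_of_le_succ fun m ω ⟨k, hk⟩ => by
    refine ⟨(m + 1) * k, ?_⟩
    convert hk using 3
    rw [Nat.factorial_succ]
    push_cast
    field_simp
  have hBA : ∀ x, P (⋃ m, B x m) ≤ 2 * P (A x) := fun x => by
    rw [(hB x).measure_iUnion]
    exact iSup_le fun m => hX.measure_exists_grid_lt_le hc m.factorial_pos x
  have hnull : P {ω | ∀ x, ω ∈ ⋃ m, B x m} = 0 := by
    refine le_antisymm (ge_of_tendsto' hA fun x => ?_) zero_le
    exact (measure_mono fun ω (hω : ∀ x, ω ∈ ⋃ m, B x m) => hω x).trans (hBA x)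
  rw [measure_eq_zero_iff_ae_notMem] at hnull
  filter_upwards [hnull] with ω hω
  simp only [not_forall] at hω
  obtain ⟨x, hx⟩ := hω
  refine ⟨X 0 ω - (x + c), fun q hq => ?_⟩
  by_contra! hlt
  refine hx (Set.mem_iUnion.2 ⟨q.den, q.num.toNat * (q.den - 1).factorial, ?_⟩)
  have h1 : (((q.num.toNat * (q.den - 1).factorial : ℕ) : ℝ) / (q.den.factorial : ℝ)) = q := by
    rw [← Nat.mul_factorial_pred q.den_nz]
    have hnum : ((q.num.toNat : ℕ) : ℝ) = q.num := by
      exact_mod_cast Int.toNat_of_nonneg (Rat.num_nonneg.2 hq)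
    have := (q.den - 1).factorial_ne_zero
    have := q.den_nz
    rw [Rat.cast_def q]
    push_cast
    rw [hnum]
    field_simp
  simp only [h1]
  linarith

/-- A process with stationary independent increments that is bounded below on the half-line and
integrable has nonnegative means, and it vanishes where its mean does. -/
theorem integral_nonneg_of_bddBelow [IsProbabilityMeasure P]
    (hX : HasStationaryIndepIncrements P X)
    (hb : ∀ᵐ ω ∂P, ∃ C : ℝ, ∀ t : ℝ, 0 ≤ t → C ≤ X t ω) {h : ℝ} (hh : 0 < h)
    (hint : Integrable (X h) P) :
    0 ≤ ∫ ω, X h ω ∂P ∧ (∫ ω, X h ω ∂P = 0 → ∀ᵐ ω ∂P, X h ω = 0) := by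
  have hid := hX.identDistrib_gridStep hh
  have key := integral_nonneg_of_walk_bddBelow (hX.measurable_gridStep h)
    (hX.iIndepFun_gridStep hh.le) (fun i => (hid i).trans (hid 0).symm) (by
      filter_upwards [hb] with ω ⟨C, hC⟩
      refine ⟨C - X 0 ω, ?_⟩
      rintro _ ⟨n, rfl⟩
      simp only [sum_range_gridStep]
      linarith [hC (n * h) (by positivity)]) ((hid 0).integrable_iff.2 hint)
  rw [(hid 0).integral_eq] at key
  refine ⟨key.1, fun h0 => ?_⟩
  exact (hid 0).ae_mem_snd (measurableSet_singleton 0) (key.2 h0)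

/-- A process with stationary independent increments growing at most linearly in both time
directions, on the lower side, is integrable. -/
theorem integrable_of_linear_minorant [IsProbabilityMeasure P]
    (hX : HasStationaryIndepIncrements P X) {α : ℝ} (hα : 0 < α)
    (hb : ∀ᵐ ω ∂P, ∃ C : ℝ, ∀ t : ℝ, C ≤ X t ω + α * |t|) {h : ℝ} (hh : 0 < h) :
    Integrable (X h) P := by
  have hR := hX.comp_neg
  have hidX := hX.identDistrib_gridStep hh
  have hidR := hR.identDistrib_gridStep hh
  -- The backward increments, with sign changed, have jointly the law of the forward ones.
  -- Boundedness below is a measurable event on sequences, so the cone at negative times yields an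
  -- upper bound at positive times.
  have hpi := IdentDistrib.pi (X := fun i ω => -gridStep (fun t => X (-t)) h i ω)
    (Y := gridStep X h)
    (fun i => (((hidR i).comp measurable_neg).trans (hX.identDistrib_neg_neg hh)).trans
      (hidX i).symm)
    ((hR.iIndepFun_gridStep hh.le).comp (fun _ x => -x) fun _ => measurable_neg)
    (hX.iIndepFun_gridStep hh.le)
  have hset : MeasurableSet {x : ℕ → ℝ |
      BddBelow (Set.range fun n : ℕ => ∑ i ∈ Finset.range n, (-x i) + α * h * n)} :=
    measurableSet_bddBelow_range fun n => by fun_prop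
  have h1 : ∀ᵐ ω ∂P, BddBelow (Set.range fun n : ℕ =>
      ∑ i ∈ Finset.range n, (-gridStep X h i ω) + α * h * n) := by
    refine hpi.ae_mem_snd hset ?_
    filter_upwards [hb] with ω ⟨C, hC⟩
    refine ⟨C - X 0 ω, ?_⟩
    rintro _ ⟨n, rfl⟩
    simp only [neg_neg, sum_range_gridStep, neg_zero]
    have := hC (-(n * h))
    rw [abs_neg, abs_of_nonneg (by positivity)] at this
    linarith
  refine (hidX 0).integrable_iff.1 (integrable_of_walk_abs_le (hX.measurable_gridStep h)
    (hX.iIndepFun_gridStep hh.le) (fun i => (hidX i).trans (hidX 0).symm)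
    (mul_pos hα hh) ?_)
  filter_upwards [hb, h1] with ω ⟨C, hC⟩ ⟨D, hD⟩
  refine ⟨max (-D) (X 0 ω - C), fun n => ?_⟩
  have h2 := hD ⟨n, rfl⟩
  have h3 := hC (n * h)
  simp only [Finset.sum_neg_distrib] at h2
  rw [abs_of_nonneg (by positivity)] at h3
  rw [abs_le]
  have := le_max_left (-D) (X 0 ω - C)
  have := le_max_right (-D) (X 0 ω - C)
  constructor
  · rw [sum_range_gridStep]
    linarith
  · linarith

lemma integral_add_time [IsProbabilityMeasure P] (hX : HasStationaryIndepIncrements P X)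
    (hint : ∀ t : ℝ, 0 < t → Integrable (X t) P) {s t : ℝ} (hs : 0 < s) (ht : 0 < t) :
    ∫ ω, X (s + t) ω ∂P = ∫ ω, X s ω ∂P + ∫ ω, X t ω ∂P := by
  have h := (hX.stationary_increments s (s + t) (by linarith)).integral_eq
  rw [integral_sub (hint _ (by linarith)) (hint _ hs), add_sub_cancel_left] at h
  linarith

/-- Under a linear minorant the mean is at least `-α`, and if the mean is `-α`, then the process
is the drift of slope `-α`. -/
theorem neg_le_integral_of_linear_minorant [IsProbabilityMeasure P]
    (hX : HasStationaryIndepIncrements P X) {α : ℝ} (hα : 0 < α)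
    (hb : ∀ᵐ ω ∂P, ∃ C : ℝ, ∀ t : ℝ, C ≤ X t ω + α * |t|) :
    -α ≤ ∫ ω, X 1 ω ∂P ∧
      (∫ ω, X 1 ω ∂P = -α → ∀ t : ℝ, 0 < t → ∀ᵐ ω ∂P, X t ω = -α * t) := by
  have hint : ∀ t : ℝ, 0 < t → Integrable (X t) P := fun t ht =>
    hX.integrable_of_linear_minorant hα hb ht
  have key : ∀ t : ℝ, 0 < t → 0 ≤ ∫ ω, X t ω ∂P + α * t ∧
      (∫ ω, X t ω ∂P + α * t = 0 → ∀ᵐ ω ∂P, X t ω + α * t = 0) := fun t ht => by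
    have := (hX.add_drift α).integral_nonneg_of_bddBelow (by
      filter_upwards [hb] with ω ⟨C, hC⟩
      refine ⟨C, fun s hs => ?_⟩
      simpa [abs_of_nonneg hs] using hC s) ht ((hint t ht).add (integrable_const _))
    rw [integral_add (hint t ht) (integrable_const _)] at this
    simpa using this
  have hmul : ∀ n : ℕ, ∫ ω, X ((n : ℝ) + 1) ω ∂P = (n + 1) * ∫ ω, X 1 ω ∂P := fun n => by
    induction n with
    | zero => simp
    | succ n ih =>
      push_cast
      rw [hX.integral_add_time hint (by positivity) one_pos, ih]
      ring
  refine ⟨by linarith [(key 1 one_pos).1], fun h1 t ht => ?_⟩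
  -- Let `n = ⌈t⌉₊ + 1`. The means at `t` and `n - t` add up to `-αn` and each is at least `-α`
  -- times its duration, so both are equalities. The extra `1` keeps `n - t` positive.
  have hlt : t < (⌈t⌉₊ : ℝ) + 1 := (Nat.le_ceil t).trans_lt (lt_add_one _)
  have h2 := hmul ⌈t⌉₊
  have h3 := hX.integral_add_time hint ht (sub_pos.2 hlt)
  rw [add_sub_cancel, h2, h1] at h3
  have h4 := (key _ (sub_pos.2 hlt)).1
  filter_upwards [(key t ht).2 (le_antisymm (by linarith) (key t ht).1)] with ω hω
  linarith

end HasStationaryIndepIncrements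

/-! ### Minorants and càdlàg paths -/

lemma exists_isLipschitzMinorant {α : ℝ} (hα : 0 ≤ α) {f : ℝ → ℝ} {C : ℝ}
    (hC : ∀ t, C ≤ f t + α * |t|) : ∃ m, IsLipschitzMinorant α f m := by
  have hb : ∀ t, BddBelow (Set.range fun s => f s + α * |t - s|) := fun t => by
    refine ⟨C - α * |t|, ?_⟩
    rintro _ ⟨s, rfl⟩
    have h1 := hC s
    have h2 : |s| ≤ |t| + |t - s| := by
      have := abs_sub_abs_le_abs_sub s t
      rw [abs_sub_comm] at this
      linarith
    have := mul_le_mul_of_nonneg_left h2 hα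
    simp only
    linarith
  refine ⟨fun t => ⨅ s, f s + α * |t - s|, ⟨?_, fun t => ?_⟩, ?_⟩
  · have key : ∀ s t : ℝ, (⨅ u, f u + α * |s - u|) - (⨅ u, f u + α * |t - u|) ≤ α * |s - t| := by
      intro s t
      rw [sub_le_iff_le_add', ← sub_le_iff_le_add]
      refine le_ciInf fun u => ?_
      have h1 := ciInf_le (hb s) u
      have h2 := mul_le_mul_of_nonneg_left (abs_sub_le s t u) hα
      linarith
    intro s t
    refine abs_le.2 ⟨?_, key s t⟩
    have := key t s
    rw [abs_sub_comm] at this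
    linarith
  · simpa using ciInf_le (hb t) t
  · rintro g ⟨hg, hgf⟩ t
    refine le_ciInf fun s => ?_
    have h1 := (abs_le.1 (hg t s)).2
    have h2 := hgf s
    linarith

lemma IsLipschitzMinorant.le_add_mul_abs {α : ℝ} {f m : ℝ → ℝ} (hm : IsLipschitzMinorant α f m)
    (t : ℝ) : m 0 ≤ f t + α * |t| := by
  have h1 := (abs_le.1 (hm.1.1 0 t)).2
  have h2 := hm.1.2 t
  rw [zero_sub, abs_neg] at h1
  linarith

lemma IsCadlagPath.bddAbove_abs_image {f : ℝ → ℝ} (hf : IsCadlagPath f) {K : Set ℝ}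
    (hK : IsCompact K) : ∃ N : ℕ, ∀ s ∈ K, |f s| ≤ N := by
  refine hK.induction_on (p := fun K => ∃ N : ℕ, ∀ s ∈ K, |f s| ≤ N) ⟨0, by simp⟩
    (fun s t hst ⟨N, hN⟩ => ⟨N, fun u hu => hN u (hst hu)⟩)
    (fun s t ⟨N, hN⟩ ⟨M, hM⟩ => ⟨max N M, fun u hu => ?_⟩) (fun t _ => ?_)
  · push_cast
    exact hu.elim (fun h => (hN u h).trans (le_max_left _ _))
      fun h => (hM u h).trans (le_max_right _ _)
  · obtain ⟨hr, l, hl⟩ := hf t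
    obtain ⟨N, hN⟩ := exists_nat_gt |f t|
    obtain ⟨M, hM⟩ := exists_nat_gt |l|
    have h1 := hr.abs.eventually (gt_mem_nhds hN)
    have h2 := hl.abs.eventually (gt_mem_nhds hM)
    refine ⟨{u | |f u| ≤ (max N M : ℕ)}, mem_nhdsWithin_of_mem_nhds ?_, max N M, fun u hu => hu⟩
    rw [← nhdsLT_sup_nhdsGE, mem_sup]
    push_cast
    exact ⟨h2.mono fun u hu => hu.le.trans (le_max_right _ _),
      h1.mono fun u hu => hu.le.trans (le_max_left _ _)⟩

/-- A closed condition on `(t, f t)` that holds at the rationals holds everywhere for a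
right-continuous `f`. -/
lemma IsCadlagPath.forall_of_rat {f : ℝ → ℝ} (hf : IsCadlagPath f) {g : ℝ → ℝ} (hg : Continuous g)
    {S : Set ℝ} (hS : IsClosed S) (h : ∀ q : ℚ, f q + g q ∈ S) (t : ℝ) : f t + g t ∈ S := by
  have hne : (𝓝[Set.range ((↑) : ℚ → ℝ) ∩ Set.Ioi t] t).NeBot := by
    rw [← mem_closure_iff_nhdsWithin_neBot, Set.inter_comm]
    exact closure_minimal (Rat.denseRange_cast.open_subset_closure_inter isOpen_Ioi)
      isClosed_closure (by simp)
  have hlim : Tendsto (fun s => f s + g s) (𝓝[Set.range ((↑) : ℚ → ℝ) ∩ Set.Ioi t] t)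
      (𝓝 (f t + g t)) :=
    ((hf t).1.add hg.continuousWithinAt).mono_left
      (nhdsWithin_mono _ (Set.inter_subset_right.trans Set.Ioi_subset_Ici_self))
  refine hS.mem_of_tendsto hlim ?_
  filter_upwards [self_mem_nhdsWithin]
  rintro _ ⟨⟨q, rfl⟩, -⟩
  exact h q

/-! ### Lévy processes -/

variable {X : ℝ → Ω → ℝ}

lemma levyExponent_zero_zero (a θ : ℝ) : levyExponent a 0 0 θ = -(Complex.I * a * θ) := by
  simp [levyExponent]

lemma levyDrift_zero (a : ℝ) : levyDrift a 0 = a := by simp [levyDrift]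

namespace IsLevyProcess

/-- Càdlàg paths are bounded on `[0, 1]`, so the increasing events `G N` exhaust the space up to a
null set. Supplies the constant for Ottaviani. -/
lemma exists_half_le_measure_abs_le [IsProbabilityMeasure P] (hX : IsLevyProcess P X) :
    ∃ N : ℕ, ∀ s ∈ Set.Icc (0 : ℝ) 1, 2⁻¹ ≤ P {ω | |X s ω| ≤ N} := by
  let G : ℕ → Set Ω := fun N => {ω | ∀ s ∈ Set.Icc (0 : ℝ) 1, |X s ω| ≤ N}
  have hG : Monotone G := fun N M hNM ω (hω : ∀ s ∈ Set.Icc (0 : ℝ) 1, |X s ω| ≤ N) s hs =>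
    (hω s hs).trans (by exact_mod_cast hNM)
  have hU : P (⋃ N, G N) = 1 := by
    rw [measure_congr (eventuallyEq_univ.2 ?_), measure_univ]
    filter_upwards [hX.cadlag] with ω hω
    obtain ⟨N, hN⟩ := hω.bddAbove_abs_image isCompact_Icc
    exact Set.mem_iUnion.2 ⟨N, hN⟩
  have hlim := tendsto_measure_iUnion_atTop (μ := P) hG
  rw [hU] at hlim
  obtain ⟨N, hN⟩ := (hlim.eventually (lt_mem_nhds (show (2⁻¹ : ENNReal) < 1 by simp))).exists
  exact ⟨N, fun s hs => hN.le.trans (measure_mono fun ω (hω : ∀ s ∈ Set.Icc (0 : ℝ) 1, _) => hω s hs)⟩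

lemma exists_linear_minorant [IsProbabilityMeasure P] (hX : IsLevyProcess P X) {α : ℝ}
    (hα : 0 < α) (hint : Integrable (X 1) P) (hmean : |∫ ω, X 1 ω ∂P| < α) :
    ∀ᵐ ω ∂P, ∃ C : ℝ, ∀ t : ℝ, C ≤ X t ω + α * |t| := by
  have hF := hX.hasStationaryIndepIncrements
  obtain ⟨N, hN⟩ := hX.exists_half_le_measure_abs_le
  obtain ⟨hlo, hhi⟩ := abs_lt.1 hmean
  -- Stated for a general `Y` to serve both `X` and its time reversal; the added drift makes the
  -- mean positive.
  have half : ∀ Y : ℝ → Ω → ℝ, HasStationaryIndepIncrements P Y → Integrable (Y 1) P →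
      -α < ∫ ω, Y 1 ω ∂P → (∀ s ∈ Set.Ioc (0 : ℝ) 1, 2⁻¹ ≤ P {ω | |Y s ω| ≤ N}) →
      ∀ᵐ ω ∂P, ∃ C : ℝ, ∀ q : ℚ, 0 ≤ q → C ≤ Y q ω + α * q := by
    intro Y hY hYi hYm hYN
    have hD := hY.add_drift α
    refine hD.exists_le_rat (c := N + α) (fun s hs => (hYN s hs).trans
      (measure_mono fun ω (hω : |Y s ω| ≤ N) => ?_))
      (hD.bddBelow_range_nat (hYi.add (integrable_const _)) ?_)
    · exact add_le_add (le_of_abs_le hω) (mul_le_of_le_one_right hα.le hs.2)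
    · rw [integral_add hYi (integrable_const _)]
      simp only [mul_one, integral_const, probReal_univ, smul_eq_mul, one_mul]
      linarith
  have hid := hF.identDistrib_neg_neg one_pos
  have hRi : Integrable (fun ω => X (-1) ω) P := by
    simpa using (hid.integrable_iff.2 hint).neg
  have hRm : ∫ ω, X (-1) ω ∂P = -∫ ω, X 1 ω ∂P := by
    rw [← hid.integral_eq, integral_neg, neg_neg]
  filter_upwards [hX.cadlag, half X hF hint hlo fun s hs => hN s ⟨hs.1.le, hs.2⟩,
    half _ hF.comp_neg hRi (by rw [hRm]; linarith) fun s hs => by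
      have h1 := (hF.identDistrib_neg_neg hs.1).measure_mem_eq
        (measurableSet_le measurable_abs measurable_const : MeasurableSet {y : ℝ | |y| ≤ N})
      refine (hN s ⟨hs.1.le, hs.2⟩).trans (h1.ge.trans (measure_mono fun ω hω => ?_))
      simpa using hω] with ω hω ⟨C, hC⟩ ⟨D, hD⟩
  refine ⟨min C D, hω.forall_of_rat (g := fun t => α * |t|) (by fun_prop) isClosed_Ici
    fun q => ?_⟩
  rcases le_total 0 q with hq | hq
  · have := hC q hq
    change min C D ≤ X q ω + α * |(q : ℝ)|
    rw [abs_of_nonneg (by exact_mod_cast hq)]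
    exact (min_le_left _ _).trans this
  · have := hD (-q) (by linarith)
    change min C D ≤ X q ω + α * |(q : ℝ)|
    rw [abs_of_nonpos (by exact_mod_cast hq)]
    push_cast at this
    rw [neg_neg] at this
    exact (min_le_right _ _).trans this

/-- If the values at positive times are those of a pure drift, so are the paths on the whole
line. -/
lemma ae_forall_eq_mul (hX : IsLevyProcess P X) {a : ℝ}
    (h : ∀ t : ℝ, 0 < t → ∀ᵐ ω ∂P, X t ω = a * t) : ∀ᵐ ω ∂P, ∀ t : ℝ, X t ω = a * t := by
  have hF := hX.hasStationaryIndepIncrements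
  have hall : ∀ t : ℝ, ∀ᵐ ω ∂P, X t ω = a * t := fun t => by
    rcases lt_trichotomy t 0 with ht | rfl | ht
    · have := (hF.identDistrib_neg_neg (neg_pos.2 ht)).symm.ae_mem_snd
        (measurableSet_singleton (a * -t)) (h _ (neg_pos.2 ht))
      filter_upwards [this] with ω hω
      simp only [neg_neg, Set.mem_singleton_iff] at hω
      linarith
    · simpa using hX.zero
    · exact h t ht
  filter_upwards [hX.cadlag, ae_all_iff.2 fun q : ℚ => hall q] with ω hω hq t
  have := hω.forall_of_rat (g := fun t => -(a * t)) (by fun_prop) (isClosed_singleton (x := 0))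
    (fun q => by simp [hq q]) t
  simp only [Set.mem_singleton_iff] at this
  linarith

lemma hasLevyTriplet_of_ae_eq_mul [IsProbabilityMeasure P] {a : ℝ}
    (h : ∀ᵐ ω ∂P, ∀ t : ℝ, X t ω = a * t) : HasLevyTriplet P X a 0 0 := by
  refine ⟨le_rfl, ⟨by simp, by simp⟩, fun t _ θ => ?_⟩
  rw [levyExponent_zero_zero, integral_congr_ae
    (g := fun _ => Complex.exp (-(t * -(Complex.I * a * θ))))]
  · simp
  · filter_upwards [h] with ω hω
    rw [hω]
    congr 1
    push_cast
    ring

lemma ae_eq_mul_of_hasLevyTriplet [IsProbabilityMeasure P] (hX : IsLevyProcess P X) {a : ℝ}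
    (h : HasLevyTriplet P X a 0 0) : ∀ᵐ ω ∂P, ∀ t : ℝ, X t ω = a * t := by
  refine hX.ae_forall_eq_mul fun t ht => ?_
  have : P.map (X t) = Measure.dirac (a * t) := by
    have := Measure.isProbabilityMeasure_map (μ := P) (hX.measurable t).aemeasurable
    refine Measure.ext_of_charFun (funext fun θ => ?_)
    rw [charFun_apply_real, integral_map (hX.measurable t).aemeasurable (by fun_prop),
      charFun_dirac]
    have h1 := h.2.2 t ht.le θ
    rw [levyExponent_zero_zero] at h1
    convert h1 using 3 with ω
    · congr 1; ring
    · simp; ring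
  have h2 : ∀ᵐ y ∂(P.map (X t)), y = a * t := by
    rw [this, ae_dirac_eq]
    rfl
  exact ae_of_ae_map (hX.measurable t).aemeasurable h2

/-- If almost every path dominates a Lipschitz cone, then the process is either a drift of slope
`±α` or integrable with mean in `(-α, α)`. -/
lemma eq_mul_or_of_linear_minorant [IsProbabilityMeasure P] (hX : IsLevyProcess P X) {α : ℝ}
    (hα : 0 < α) (hb : ∀ᵐ ω ∂P, ∃ C : ℝ, ∀ t : ℝ, C ≤ X t ω + α * |t|) :
    ((∀ᵐ ω ∂P, ∀ t : ℝ, X t ω = α * t) ∨ (∀ᵐ ω ∂P, ∀ t : ℝ, X t ω = -α * t)) ∨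
      (Integrable (X 1) P ∧ |∫ ω, X 1 ω ∂P| < α) := by
  have hF := hX.hasStationaryIndepIncrements
  obtain ⟨h1, h1'⟩ := hF.neg_le_integral_of_linear_minorant hα hb
  obtain ⟨h2, h2'⟩ := hF.comp_neg.neg_le_integral_of_linear_minorant hα (by
    filter_upwards [hb] with ω ⟨C, hC⟩
    exact ⟨C, fun t => by simpa using hC (-t)⟩)
  have hm : ∫ ω, X (-1) ω ∂P = -∫ ω, X 1 ω ∂P := by
    rw [← (hF.identDistrib_neg_neg one_pos).integral_eq, integral_neg, neg_neg]
  rw [hm] at h2 h2'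
  by_cases hlo : ∫ ω, X 1 ω ∂P = -α
  · exact .inl (.inr (hX.ae_forall_eq_mul (h1' hlo)))
  by_cases hhi : ∫ ω, X 1 ω ∂P = α
  · refine .inl (.inl (hX.ae_forall_eq_mul fun t ht => ?_))
    have := (hF.identDistrib_neg_neg ht).ae_mem_snd (measurableSet_singleton (α * t)) (by
      filter_upwards [h2' (by rw [hhi]) t ht] with ω hω
      simp [hω])
    exact this
  · refine .inr ⟨hF.integrable_of_linear_minorant hα hb one_pos, abs_lt.2 ⟨?_, ?_⟩⟩
    · exact lt_of_le_of_ne h1 (Ne.symm hlo)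
    · exact lt_of_le_of_ne (by linarith) hhi

/-- With `σ = 0` and `ν = 0` the characteristic function is that of a point mass at `at`, so the
triplet identifies the drift directly. -/
lemma exists_triplet_iff [IsProbabilityMeasure P] (hX : IsLevyProcess P X) {α : ℝ} (hα : 0 < α) :
    (∃ (a σ : ℝ) (ν : Measure ℝ), HasLevyTriplet P X a σ ν ∧
        σ = 0 ∧ ν = 0 ∧ |levyDrift a ν| = α) ↔
      ((∀ᵐ ω ∂P, ∀ t : ℝ, X t ω = α * t) ∨ (∀ᵐ ω ∂P, ∀ t : ℝ, X t ω = -(α * t))) := by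
  constructor
  · rintro ⟨a, _, _, h, rfl, rfl, ha⟩
    rw [levyDrift_zero] at ha
    have := hX.ae_eq_mul_of_hasLevyTriplet h
    rcases eq_or_eq_neg_of_abs_eq ha with rfl | rfl
    · exact .inl this
    · exact .inr (by simpa only [neg_mul] using this)
  · rintro (h | h)
    · exact ⟨α, 0, 0, hasLevyTriplet_of_ae_eq_mul h, rfl, rfl, by
        rw [levyDrift_zero, abs_of_pos hα]⟩
    · exact ⟨-α, 0, 0, hasLevyTriplet_of_ae_eq_mul (by simpa only [neg_mul] using h), rfl, rfl, by
        rw [levyDrift_zero, abs_neg, abs_of_pos hα]⟩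

end IsLevyProcess

end

theorem propositionP {Ω : Type*} [MeasurableSpace Ω] (P : Measure Ω) [IsProbabilityMeasure P]
    (X : ℝ → Ω → ℝ) (hX : IsLevyProcess P X) (α : ℝ) (hα : 0 < α) :
    ((∀ᵐ ω ∂P, ∃ m : ℝ → ℝ, IsLipschitzMinorant α (fun t => X t ω) m) ↔
      ((∃ (a σ : ℝ) (ν : Measure ℝ), HasLevyTriplet P X a σ ν ∧
          σ = 0 ∧ ν = 0 ∧ |levyDrift a ν| = α) ∨
        (Integrable (X 1) P ∧ |∫ ω, X 1 ω ∂P| < α))) ∧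
    ((∃ (a σ : ℝ) (ν : Measure ℝ), HasLevyTriplet P X a σ ν ∧
        σ = 0 ∧ ν = 0 ∧ |levyDrift a ν| = α) ↔
      ((∀ᵐ ω ∂P, ∀ t : ℝ, X t ω = α * t) ∨ (∀ᵐ ω ∂P, ∀ t : ℝ, X t ω = -(α * t)))) := by
  refine ⟨?_, hX.exists_triplet_iff hα⟩
  rw [hX.exists_triplet_iff hα]
  constructor
  · intro h
    simpa only [neg_mul] using hX.eq_mul_or_of_linear_minorant hα
      (h.mono fun ω ⟨m, hm⟩ => ⟨m 0, hm.le_add_mul_abs⟩)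
  · intro h
    have hb : ∀ᵐ ω ∂P, ∃ C : ℝ, ∀ t : ℝ, C ≤ X t ω + α * |t| := by
      rcases h with (h | h) | ⟨hint, hmean⟩
      · filter_upwards [h] with ω hω
        refine ⟨0, fun t => ?_⟩
        rw [hω]
        nlinarith [neg_abs_le t]
      · filter_upwards [h] with ω hω
        refine ⟨0, fun t => ?_⟩
        rw [hω]
        nlinarith [le_abs_self t]
      · exact hX.exists_linear_minorant hα hint hmean
    filter_upwards [hb] with ω ⟨C, hC⟩
    exact exists_isLipschitzMinorant hα.le hC
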